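/- Let $X$ be an infinite compact metric space and let $T\colon X\to X$ be a continuous map. Suppose that $(X,T)$ is transitive, i.e. for any two nonempty open sets $U,V\subset X$ there is $n>0$ with $T^n(U)\cap V\neq\emptyset$, and that $(X,T)$ has the shadowing property, i.e. for every $\varepsilon>0$ there is $\delta>0$ such that for every sequence $(x_n)_{n\ge 0}$ in $X$ with $d(T(x_n),x_{n+1})<\delta$ for all $n\ge 0$ there is a point $y\in X$ with $d(T^n(y),x_n)<\varepsilon$ for all $n\ge 0$. Let $M_T(X)$ be the space of $T$-invariant Borel probability measures on $X$ with the weak$^*$ topology. Then the set of non-atomic ergodic measures (those ergodic $\mu\in M_T(X)$ with $\mu(\{x\})=0$ for all $x\in X$) is residual in $M_T(X)$, i.e. its complement in $M_T(X)$ is of first category (contained in a countable union of closed nowhere dense subsets of $M_T(X)$). -/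

import Mathlib

open MeasureTheory

/-- A self-map `T` of a topological space is (topologically) transitive: for any two nonempty open
sets `U`, `V` there is `n > 0` with `T^n(U) ∩ V ≠ ∅`. -/
def IsTransitiveMap {X : Type*} [TopologicalSpace X] (T : X → X) : Prop :=
  ∀ U V : Set X, IsOpen U → IsOpen V → U.Nonempty → V.Nonempty →
    ∃ n : ℕ, 0 < n ∧ ((T^[n] '' U) ∩ V).Nonempty

/-- The sequence `x` is a `δ`-pseudo-orbit of `T`. -/
def IsPseudoOrbit {X : Type*} [MetricSpace X] (T : X → X) (δ : ℝ) (x : ℕ → X) : Prop :=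
  ∀ n : ℕ, dist (T (x n)) (x (n + 1)) < δ

/-- The shadowing property: for every `ε > 0` there is `δ > 0` such that every `δ`-pseudo-orbit
is `ε`-traced by some point. -/
def HasShadowing {X : Type*} [MetricSpace X] (T : X → X) : Prop :=
  ∀ ε : ℝ, 0 < ε → ∃ δ : ℝ, 0 < δ ∧ ∀ x : ℕ → X, IsPseudoOrbit T δ x →
    ∃ y : X, ∀ n : ℕ, dist (T^[n] y) (x n) < ε

/-- The set `M_T(X)` of `T`-invariant Borel probability measures on `X`. As a type it carries the
subspace topology of the topology of weak convergence (the weak-* topology) on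
`ProbabilityMeasure X`. -/
def invariantMeasures {X : Type*} [MeasurableSpace X] (T : X → X) :
    Set (ProbabilityMeasure X) :=
  {μ | MeasurePreserving T (μ : Measure X) (μ : Measure X)}

open Filter Topology Set Function

open scoped ENNReal BoundedContinuousFunction

/-! The good set contains a countable intersection of dense open sets of two kinds: measures all of
whose atoms have mass below 1/(k+1), and measures for which some Birkhoff average of a given
observable has variance below 1/(k+1). Observables from a countable dense subset of C(X, ℝ) suffice,
by `ergodic_of_birkhoffAverage_variance`. Since the length of the average may depend on the measure,
the second condition is open.

Both density statements come from `exists_mem_invariantMeasures_near`. Given an invariant μ and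
finitely many observables, transitivity yields a periodic pseudo-orbit of period n whose averages
are close to the μ-integrals and which visits a prescribed finite set A
(`exists_periodic_isPseudoOrbit_average_near`). By shadowing, the points tracing some shift of it
form a nonempty closed forward-invariant set, which carries an invariant ν by Krylov–Bogoliubov. On
this set the averages of length n are nearly constant, so ν is near μ and the variances are small;
every orbit there passes near all points of A, so atoms have mass at most 1/|A|.

The pseudo-orbit needs no pointwise ergodic theorem: averages over loops through a base point have
convex closure, and uniformly approximate long Birkhoff averages, whose integral is that of the
observable. -/

/-! ### Existence of invariant measures. -/

/-- The **Krylov–Bogoliubov theorem** for compact metric spaces. -/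
theorem exists_invariant_probabilityMeasure {Z : Type*} [MetricSpace Z] [CompactSpace Z]
    [Nonempty Z] [MeasurableSpace Z] [BorelSpace Z] (S : Z → Z) (hS : Continuous S) :
    ∃ ν : ProbabilityMeasure Z, MeasurePreserving S (ν : Measure Z) (ν : Measure Z) := by
  obtain ⟨y⟩ := ‹Nonempty Z›
  let m : ℕ → Measure Z := fun n =>
    (n + 1 : ℝ≥0∞)⁻¹ • ∑ i ∈ Finset.range (n + 1), Measure.dirac (S^[i] y)
  have hm : ∀ n, IsProbabilityMeasure (m n) := fun n => ⟨by
    simp only [m, Measure.smul_apply, Measure.coe_finsetSum, Finset.sum_apply, measure_univ,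
      Finset.sum_const, Finset.card_range, nsmul_eq_mul, smul_eq_mul, mul_one]
    push_cast
    exact ENNReal.inv_mul_cancel (by simp) (by finiteness)⟩
  have hint : ∀ n (f : Z →ᵇ ℝ), ∫ z, f z ∂(m n) =
      (n + 1 : ℝ)⁻¹ * ∑ i ∈ Finset.range (n + 1), f (S^[i] y) := by
    intro n f
    simp only [m]
    rw [integral_smul_measure, integral_finsetSum_measure (fun i _ => f.integrable _)]
    simp [integral_dirac, ENNReal.toReal_inv, ENNReal.toReal_add]
  let p : ℕ → ProbabilityMeasure Z := fun n => ⟨m n, hm n⟩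
  let u : Ultrafilter ℕ := hyperfilter ℕ
  have hu : (u : Filter ℕ) ≤ atTop := by
    rw [← Nat.cofinite_eq_atTop]; exact hyperfilter_le_cofinite
  let ν : ProbabilityMeasure Z := @Ultrafilter.lim _ _ (u.map p)
  have hν : Tendsto p u (𝓝 ν) := (u.map p).le_nhds_lim
  refine ⟨ν, hS.measurable, ?_⟩
  have : IsProbabilityMeasure (Measure.map S (ν : Measure Z)) :=
    Measure.isProbabilityMeasure_map hS.aemeasurable
  refine ext_of_forall_integral_eq_of_IsFiniteMeasure fun f => ?_
  rw [integral_map hS.aemeasurable f.continuous.aestronglyMeasurable]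
  have h1 := ProbabilityMeasure.tendsto_iff_forall_integral_tendsto.1 hν f
  have h2 := ProbabilityMeasure.tendsto_iff_forall_integral_tendsto.1 hν
    (f.compContinuous ⟨S, hS⟩)
  -- The difference telescopes to two boundary terms, hence is at most 2‖f‖/(n+1).
  have h3 : Tendsto (fun n : ℕ => ∫ z, (f.compContinuous ⟨S, hS⟩) z ∂(m n) - ∫ z, f z ∂(m n))
      u (𝓝 0) := by
    refine Tendsto.mono_left ?_ hu
    have hb : Tendsto (fun n : ℕ => (1 / ((n : ℝ) + 1)) * (2 * ‖f‖)) atTop (𝓝 0) := by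
      simpa using (tendsto_one_div_add_atTop_nhds_zero_nat (𝕜 := ℝ)).mul_const (2 * ‖f‖)
    refine squeeze_zero_norm (fun n => ?_) hb
    rw [hint, hint, ← mul_sub, ← Finset.sum_sub_distrib, norm_mul]
    have : ∑ i ∈ Finset.range (n + 1), ((f.compContinuous ⟨S, hS⟩) (S^[i] y) - f (S^[i] y)) =
        f (S^[n + 1] y) - f y := by
      have h := Finset.sum_range_sub (fun i => f (S^[i] y)) (n + 1)
      simpa [iterate_succ_apply'] using h
    rw [this]
    have h0 : (0 : ℝ) ≤ (n + 1 : ℝ)⁻¹ := by positivity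
    rw [Real.norm_of_nonneg h0, one_div]
    refine mul_le_mul_of_nonneg_left ?_ h0
    calc _ ≤ ‖f (S^[n + 1] y)‖ + ‖f y‖ := norm_sub_le _ _
      _ ≤ _ := by linarith [f.norm_coe_le_norm (S^[n + 1] y), f.norm_coe_le_norm y]
  have h4 := tendsto_nhds_unique (h2.sub h1) h3
  exact sub_eq_zero.1 h4

theorem exists_mem_invariantMeasures_of_isClosed {X : Type*} [MetricSpace X] [CompactSpace X]
    [MeasurableSpace X] [BorelSpace X] {T : X → X} (hT : Continuous T) {Z : Set X}
    (hZ : IsClosed Z) (hne : Z.Nonempty) (hm : MapsTo T Z Z) :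
    ∃ ν ∈ invariantMeasures T, (ν : Measure X) Zᶜ = 0 := by
  have : CompactSpace Z := isCompact_iff_compactSpace.1 hZ.isCompact
  have : Nonempty Z := hne.to_subtype
  obtain ⟨ν, hν⟩ := exists_invariant_probabilityMeasure (hm.restrict T Z Z)
    (hT.restrict hm)
  have hc : Measurable (Subtype.val : Z → X) := measurable_subtype_coe
  refine ⟨ν.map hc.aemeasurable, ?_, ?_⟩
  · refine ⟨hT.measurable, ?_⟩
    rw [ProbabilityMeasure.toMeasure_map, Measure.map_map hT.measurable hc]
    conv_rhs => rw [← hν.map_eq]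
    rw [Measure.map_map hc hν.measurable]
    rfl
  · rw [ProbabilityMeasure.toMeasure_map, Measure.map_apply hc hZ.measurableSet.compl]
    simp

/-! ### Birkhoff averages and a variance criterion for ergodicity. -/

theorem integral_birkhoffAverage {X E : Type*} [NormedAddCommGroup E] [NormedSpace ℝ E]
    [MeasurableSpace X] {T : X → X} {μ : Measure X} (hμ : MeasurePreserving T μ μ) {f : X → E}
    (hf : Integrable f μ) {n : ℕ} (hn : n ≠ 0) :
    ∫ x, birkhoffAverage ℝ T f n x ∂μ = ∫ x, f x ∂μ := by
  simp only [birkhoffAverage, birkhoffSum]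
  have hi : ∀ i, Integrable (fun x => f (T^[i] x)) μ := fun i =>
    (hμ.iterate i).integrable_comp_of_integrable hf
  have he : ∀ i, ∫ x, f (T^[i] x) ∂μ = ∫ x, f x ∂μ := fun i => by
    have h := (hμ.iterate i).map_eq
    conv_rhs => rw [← h]
    rw [integral_map (hμ.iterate i).measurable.aemeasurable]
    rw [h]; exact hf.aestronglyMeasurable
  rw [integral_smul, integral_finsetSum _ (fun i _ => hi i)]
  simp only [he, Finset.sum_const, Finset.card_range]
  rw [← Nat.cast_smul_eq_nsmul ℝ, inv_smul_smul₀ (by exact_mod_cast hn)]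

theorem continuous_birkhoffAverage {X E : Type*} [NormedAddCommGroup E] [NormedSpace ℝ E]
    [TopologicalSpace X] {T : X → X} (hT : Continuous T) {f : X → E} (hf : Continuous f) (n : ℕ) :
    Continuous (birkhoffAverage ℝ T f n) := by
  unfold birkhoffAverage birkhoffSum
  have := fun i => hf.comp (hT.iterate i)
  simp only [Function.comp_def] at this
  fun_prop

theorem Continuous.integrable_of_compactSpace {X E : Type*} [TopologicalSpace X] [CompactSpace X]
    [MeasurableSpace X] [OpensMeasurableSpace X] [NormedAddCommGroup E] [SecondCountableTopology E]
    {μ : Measure X} [IsFiniteMeasure μ] {f : X → E} (hf : Continuous f) : Integrable f μ :=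
  hf.integrable_of_hasCompactSupport (HasCompactSupport.of_compactSpace f)

theorem abs_birkhoffAverage_le {X : Type*} (T : X → X) (f : X → ℝ) (n : ℕ) (x : X) :
    |birkhoffAverage ℝ T f n x| ≤ birkhoffAverage ℝ T (fun z => |f z|) n x := by
  simp only [birkhoffAverage, birkhoffSum, smul_eq_mul, abs_mul]
  rw [abs_of_nonneg (by positivity : (0 : ℝ) ≤ (n : ℝ)⁻¹)]
  exact mul_le_mul_of_nonneg_left (Finset.abs_sum_le_sum_abs _ _) (by positivity)

theorem integrable_birkhoffAverage {X : Type*} [MeasurableSpace X] {T : X → X} {μ : Measure X}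
    (hμ : MeasurePreserving T μ μ) {f : X → ℝ} (hf : Integrable f μ) (n : ℕ) :
    Integrable (birkhoffAverage ℝ T f n) μ := by
  unfold birkhoffAverage birkhoffSum
  exact Integrable.smul (n : ℝ)⁻¹ (integrable_finsetSum _ fun i _ =>
    (hμ.iterate i).integrable_comp_of_integrable hf)

/-- The left side is convenient for estimates; on the right the integrands do not depend on μ, which
makes weak* continuity visible. -/
theorem integral_birkhoffAverage_sub_sq {X : Type*} [TopologicalSpace X] [CompactSpace X]
    [MeasurableSpace X] [OpensMeasurableSpace X] {T : X → X} (hT : Continuous T)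
    {μ : Measure X} [IsProbabilityMeasure μ] (hμ : MeasurePreserving T μ μ) {f : X → ℝ}
    (hf : Continuous f) {n : ℕ} (hn : n ≠ 0) :
    ∫ x, (birkhoffAverage ℝ T f n x - ∫ y, f y ∂μ) ^ 2 ∂μ =
      ∫ x, (birkhoffAverage ℝ T f n x) ^ 2 ∂μ - (∫ y, f y ∂μ) ^ 2 := by
  set c := ∫ y, f y ∂μ
  have hA := continuous_birkhoffAverage hT hf n
  have h1 : ∫ x, birkhoffAverage ℝ T f n x ∂μ = c :=
    integral_birkhoffAverage hμ hf.integrable_of_compactSpace hn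
  have h2 : ∀ x, (birkhoffAverage ℝ T f n x - c) ^ 2 =
      (birkhoffAverage ℝ T f n x) ^ 2 - (2 * c * birkhoffAverage ℝ T f n x - c ^ 2) :=
    fun x => by ring
  simp only [h2]
  rw [integral_sub (by fun_prop : Continuous _).integrable_of_compactSpace
    (by fun_prop : Continuous _).integrable_of_compactSpace,
    integral_sub (hA.const_mul _).integrable_of_compactSpace (integrable_const _),
    integral_const_mul, h1]
  simp
  ring

/-- If, for a dense set of continuous observables, some Birkhoff averages have arbitrarily small
variance, then the invariant measure is ergodic. -/
theorem ergodic_of_birkhoffAverage_variance {X : Type*} [MetricSpace X] [CompactSpace X]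
    [MeasurableSpace X] [BorelSpace X] {T : X → X} (hT : Continuous T) {μ : Measure X}
    [IsProbabilityMeasure μ] (hμ : MeasurePreserving T μ μ) {D : Set C(X, ℝ)} (hD : Dense D)
    (h : ∀ f ∈ D, ∀ ε : ℝ, 0 < ε → ∃ n : ℕ, n ≠ 0 ∧
      ∫ x, (birkhoffAverage ℝ T f n x) ^ 2 ∂μ - (∫ x, f x ∂μ) ^ 2 < ε) :
    Ergodic T μ := by
  refine ⟨hμ, ⟨fun s hs hTs => ?_⟩⟩
  set χ : X → ℝ := s.indicator fun _ => 1
  have hχi : Integrable χ μ := (integrable_const _).indicator hs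
  have hχT : χ ∘ T = χ := by
    funext x
    have : T x ∈ s ↔ x ∈ s := by rw [← mem_preimage, hTs]
    by_cases hx : x ∈ s <;> simp [χ, hx, this.2, this]
  set t : ℝ := μ.real s
  have ht0 : 0 ≤ t := measureReal_nonneg
  have ht1 : t ≤ 1 := measureReal_le_one
  have hχint : ∫ x, χ x ∂μ = t := by simp [χ, integral_indicator hs, t]
  have key : ∀ ε : ℝ, 0 < ε → t * (1 - t) ≤ 3 * ε := by
    intro ε hε
    obtain ⟨g, hg, -⟩ := hχi.exists_boundedContinuous_integral_sub_le hε
    obtain ⟨f, hfD, hfg⟩ := hD.exists_dist_lt g.toContinuousMap hε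
    have hfi : Integrable (f : X → ℝ) μ := f.continuous.integrable_of_compactSpace
    have hd : ∫ x, |χ x - f x| ∂μ ≤ 2 * ε := by
      calc ∫ x, |χ x - f x| ∂μ ≤ ∫ x, (‖χ x - g x‖ + ε) ∂μ := by
            refine integral_mono (hχi.sub hfi).abs
              ((hχi.sub (g.integrable μ)).norm.add (integrable_const _)) fun x => ?_
            have h1 : dist (g x) (f x) < ε :=
              (ContinuousMap.dist_apply_le_dist (f := g.toContinuousMap) (g := f) x).trans_lt hfg
            rw [Real.dist_eq] at h1
            rw [Real.norm_eq_abs]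
            have := abs_sub_le (χ x) (g x) (f x)
            linarith
        _ ≤ 2 * ε := by
            rw [integral_add (f := fun x => ‖χ x - g x‖) (hχi.sub (g.integrable μ)).norm
              (integrable_const _)]
            simp only [integral_const, probReal_univ, one_smul]
            linarith
    obtain ⟨n, hn, hvar⟩ := h f hfD (ε ^ 2) (by positivity)
    rw [← integral_birkhoffAverage_sub_sq hT hμ f.continuous hn] at hvar
    set c := ∫ x, f x ∂μ
    have hA := continuous_birkhoffAverage hT f.continuous n
    have h2 : ∫ x, |birkhoffAverage ℝ T f n x - c| ∂μ ≤ ε := by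
      have hsq : Integrable (fun x => (birkhoffAverage ℝ T f n x - c) ^ 2) μ :=
        (by fun_prop : Continuous _).integrable_of_compactSpace
      calc ∫ x, |birkhoffAverage ℝ T f n x - c| ∂μ
          ≤ ∫ x, ((2 * ε)⁻¹ * (birkhoffAverage ℝ T f n x - c) ^ 2 + ε / 2) ∂μ := by
            refine integral_mono (by fun_prop : Continuous _).integrable_of_compactSpace
              ((hsq.const_mul _).add (integrable_const _)) fun x => ?_
            set a := birkhoffAverage ℝ T f n x - c
            -- Completing the square gives |a| ≤ a²/(2ε) + ε/2, which replaces Cauchy–Schwarz.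
            have h3 : 0 ≤ (2 * ε)⁻¹ * (|a| - ε) ^ 2 := by positivity
            have h4 : (2 * ε)⁻¹ * (|a| - ε) ^ 2 = (2 * ε)⁻¹ * a ^ 2 + ε / 2 - |a| := by
              rw [← sq_abs a]; field_simp; ring
            simp only
            linarith
        _ = (2 * ε)⁻¹ * ∫ x, (birkhoffAverage ℝ T f n x - c) ^ 2 ∂μ + ε / 2 := by
            rw [integral_add (hsq.const_mul _) (integrable_const _), integral_const_mul]
            simp
        _ ≤ (2 * ε)⁻¹ * ε ^ 2 + ε / 2 := by gcongr
        _ = ε := by field_simp; ring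
    have h5 : ∫ x, |χ x - birkhoffAverage ℝ T f n x| ∂μ ≤ 2 * ε := by
      have hi := (hχi.sub hfi).abs
      have h6 := integral_birkhoffAverage hμ hi hn
      refine le_trans (integral_mono ?_ (integrable_birkhoffAverage hμ hi n) fun x => ?_)
        (h6.trans_le hd)
      · exact (hχi.sub hA.integrable_of_compactSpace).abs
      -- The invariant function χ equals its own Birkhoff averages.
      · have h7 := abs_birkhoffAverage_le T (χ - f) n x
        rwa [birkhoffAverage_sub, Pi.sub_apply, Pi.sub_apply,
          birkhoffAverage_of_comp_eq ℝ hχT (by exact_mod_cast hn)] at h7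
    have h8 : ∫ x, |χ x - c| ∂μ ≤ 3 * ε := by
      have hi1 := (hχi.sub (hA.integrable_of_compactSpace (μ := μ))).abs
      have hi2 : Integrable (fun x => |birkhoffAverage ℝ T f n x - c|) μ :=
        (by fun_prop : Continuous _).integrable_of_compactSpace
      refine (integral_mono (hχi.sub (integrable_const c)).abs (hi1.add hi2)
        fun x => abs_sub_le _ (birkhoffAverage ℝ T f n x) _).trans ?_
      have := integral_add hi1 hi2
      simp only [Pi.add_apply, Pi.sub_apply] at this ⊢
      linarith
    have h9 : ∫ x, |χ x - c| ∂μ = t * |1 - c| + (1 - t) * |c| := by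
      have : ∀ x, |χ x - c| = χ x * (|1 - c| - |c|) + |c| := fun x => by
        by_cases hx : x ∈ s <;> simp [χ, hx]
      simp only [this]
      rw [integral_add (hχi.mul_const _) (integrable_const _), integral_mul_const, hχint]
      simp
      ring
    rw [h9] at h8
    have h10 : 1 ≤ |1 - c| + |c| := by
      have := abs_add_le (1 - c) c
      simpa using this
    -- Both t and 1 - t dominate t(1 - t), so the left side of `h8` is at least t(1 - t)(|1 - c| +
    -- |c|).
    nlinarith [abs_nonneg (1 - c), abs_nonneg c, mul_nonneg ht0 (sub_nonneg.2 ht1),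
      mul_nonneg (mul_nonneg ht0 ht0) (abs_nonneg (1 - c)),
      mul_nonneg (mul_nonneg (sub_nonneg.2 ht1) (sub_nonneg.2 ht1)) (abs_nonneg c)]
  have h0 : t * (1 - t) ≤ 0 := by
    refine le_of_forall_pos_le_add fun ε hε => ?_
    have := key (ε / 3) (by positivity)
    linarith
  have h1 : t = 0 ∨ t = 1 := by
    have : t * (1 - t) = 0 := le_antisymm h0 (mul_nonneg ht0 (sub_nonneg.2 ht1))
    rcases mul_eq_zero.1 this with h | h
    · exact Or.inl h
    · exact Or.inr (by linarith)
  rw [eventuallyConst_set']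
  rcases h1 with h | h
  · left
    rw [ae_eq_empty]
    exact (measureReal_eq_zero_iff).1 h
  · right
    rw [ae_eq_univ, prob_compl_eq_zero_iff hs]
    simpa [t, Measure.real, ENNReal.toReal_eq_one_iff] using h

/-! ### Openness of the two conditions. -/

theorem continuous_integral_probabilityMeasure {X : Type*} [TopologicalSpace X] [CompactSpace X]
    [MeasurableSpace X] [OpensMeasurableSpace X] {f : X → ℝ} (hf : Continuous f) :
    Continuous fun μ : ProbabilityMeasure X => ∫ x, f x ∂(μ : Measure X) :=
  continuous_iff_continuousAt.2 fun _ =>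
    ProbabilityMeasure.tendsto_iff_forall_integral_tendsto.1 tendsto_id
      (BoundedContinuousFunction.mkOfCompact ⟨f, hf⟩)

theorem isOpen_setOf_birkhoffAverage_variance_lt {X : Type*} [TopologicalSpace X]
    [CompactSpace X] [MeasurableSpace X] [OpensMeasurableSpace X] {T : X → X}
    (hT : Continuous T) (f : C(X, ℝ)) (ε : ℝ) :
    IsOpen {μ : ProbabilityMeasure X | ∃ n : ℕ, n ≠ 0 ∧
      ∫ x, (birkhoffAverage ℝ T f n x) ^ 2 ∂(μ : Measure X) -
        (∫ x, f x ∂(μ : Measure X)) ^ 2 < ε} := by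
  simp only [ofPred_exists]
  refine isOpen_iUnion fun n => ?_
  by_cases hn : n = 0
  · simp [hn]
  simp only [ne_eq, hn, not_false_eq_true, true_and]
  exact isOpen_lt ((continuous_integral_probabilityMeasure
    ((continuous_birkhoffAverage hT f.continuous n).pow 2)).sub
    ((continuous_integral_probabilityMeasure f.continuous).pow 2)) continuous_const

/-- Near each x a small closed ball still has mass below ε, and this persists for nearby measures by
the portmanteau theorem; compactness of X makes the neighbourhood of μ uniform in x. -/
theorem isOpen_setOf_forall_measure_singleton_lt {X : Type*} [MetricSpace X] [CompactSpace X]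
    [MeasurableSpace X] [BorelSpace X] (ε : ℝ≥0∞) :
    IsOpen {μ : ProbabilityMeasure X | ∀ x : X, (μ : Measure X) {x} < ε} := by
  refine isOpen_iff_mem_nhds.2 fun μ hμ => ?_
  have := isCompact_univ.eventually_forall_of_forall_eventually (x₀ := μ) (K := (univ : Set X))
    (P := fun ν x => (ν : Measure X) {x} < ε) fun x _ => by
      have h1 : Tendsto (fun r : ℝ => (μ : Measure X) (Metric.closedBall x r)) (𝓝[>] 0)
          (𝓝 ((μ : Measure X) {x})) := by
        have := tendsto_measure_cthickening_of_isClosed (μ := (μ : Measure X)) (s := {x})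
          ⟨1, one_pos, by finiteness⟩ isClosed_singleton
        refine (this.mono_left nhdsWithin_le_nhds).congr' ?_
        filter_upwards [self_mem_nhdsWithin] with r hr
        rw [Metric.cthickening_singleton _ (le_of_lt hr)]
      obtain ⟨r, hr, hr0⟩ := ((h1.eventually_lt_const (hμ x)).and self_mem_nhdsWithin).exists
      have h2 : ∀ᶠ ν : ProbabilityMeasure X in 𝓝 μ,
          (ν : Measure X) (Metric.closedBall x r) < ε :=
        eventually_lt_of_limsup_lt
          ((ProbabilityMeasure.limsup_measure_closed_le_of_tendsto tendsto_id
            Metric.isClosed_closedBall).trans_lt hr)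
      rw [nhds_prod_eq]
      filter_upwards [h2.prod_mk (Metric.closedBall_mem_nhds x hr0)] with z hz
      have hz2 : z.2 ∈ Metric.closedBall x r := hz.2
      exact (measure_mono (singleton_subset_iff.2 hz2)).trans_lt hz.1
  filter_upwards [this] with ν hν x
  exact hν x (mem_univ x)

/-! ### Pseudo-orbit chains and loops. -/

/-- The points `x 0 = u, …, x n = v` form a `δ`-chain of `T` from `u` to `v`. -/
structure IsPseudoChain {X : Type*} [MetricSpace X] (T : X → X) (δ : ℝ) (u v : X) (n : ℕ)
    (x : ℕ → X) : Prop where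
  start : x 0 = u
  finish : x n = v
  step : ∀ i < n, dist (T (x i)) (x (i + 1)) < δ

/-- The sequence which follows `x` up to time `n` and `y` afterwards. -/
def concatAt {X : Type*} (n : ℕ) (x y : ℕ → X) : ℕ → X :=
  fun i => if i < n then x i else y (i - n)

theorem concatAt_of_lt {X : Type*} {n i : ℕ} (h : i < n) (x y : ℕ → X) :
    concatAt n x y i = x i := if_pos h

theorem concatAt_add {X : Type*} (n i : ℕ) (x y : ℕ → X) : concatAt n x y (n + i) = y i := by
  simp [concatAt]

theorem sum_concatAt {X E : Type*} [AddCommMonoid E] (φ : X → E) (n m : ℕ) (x y : ℕ → X) :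
    ∑ i ∈ Finset.range (n + m), φ (concatAt n x y i) =
      ∑ i ∈ Finset.range n, φ (x i) + ∑ i ∈ Finset.range m, φ (y i) := by
  rw [Finset.sum_range_add]
  congr 1
  · exact Finset.sum_congr rfl fun i hi => by rw [concatAt_of_lt (Finset.mem_range.1 hi)]
  · simp only [concatAt_add]

section

variable {X : Type*} [MetricSpace X] {T : X → X} {δ : ℝ}

theorem IsPseudoChain.concat {u v w : X} {n m : ℕ} {x y : ℕ → X}
    (hx : IsPseudoChain T δ u v n x) (hy : IsPseudoChain T δ v w m y) :
    IsPseudoChain T δ u w (n + m) (concatAt n x y) := by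
  refine ⟨?_, by rw [concatAt_add, hy.finish], fun i hi => ?_⟩
  · rcases Nat.eq_zero_or_pos n with rfl | hn
    · simp [concatAt, hy.start, ← hx.finish, hx.start]
    · rw [concatAt_of_lt hn, hx.start]
  · rcases lt_trichotomy (i + 1) n with h | h | h
    · rw [concatAt_of_lt h, concatAt_of_lt (by omega)]
      exact hx.step i (by omega)
    · have h1 : concatAt n x y (i + 1) = x (i + 1) := by
        rw [h, hx.finish, ← hy.start]
        exact concatAt_add n 0 x y
      rw [h1, concatAt_of_lt (by omega)]
      exact hx.step i (by omega)
    · obtain ⟨j, rfl⟩ := Nat.exists_eq_add_of_le (Nat.lt_succ_iff.1 h)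
      rw [add_assoc, concatAt_add, concatAt_add]
      exact hy.step j (by omega)

theorem isPseudoChain_orbit (T : X → X) (hδ : 0 < δ) (u : X) (n : ℕ) :
    IsPseudoChain T δ u (T^[n] u) n fun i => T^[i] u :=
  ⟨rfl, rfl, fun i _ => by simpa [iterate_succ_apply'] using hδ⟩

theorem exists_isPseudoChain_of_dist_lt {u v w : X} {k : ℕ} (hk : 0 < k)
    (h1 : dist (T u) w < δ) (h2 : dist (T^[k] w) v < δ) :
    ∃ x, IsPseudoChain T δ u v (k + 1) x := by
  obtain ⟨k, rfl⟩ := Nat.exists_eq_succ_of_ne_zero hk.ne'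
  have hδ : 0 < δ := dist_nonneg.trans_lt h1
  have hx : IsPseudoChain T δ u w 1 (fun i => if i = 0 then u else w) :=
    ⟨by simp, by simp, fun i hi => by
      obtain rfl : i = 0 := by omega
      simpa using h1⟩
  have hz : IsPseudoChain T δ (T^[k] w) v 1 (fun i => if i = 0 then T^[k] w else v) :=
    ⟨by simp, by simp, fun i hi => by
      obtain rfl : i = 0 := by omega
      simpa [iterate_succ_apply'] using h2⟩
  have := (hx.concat (isPseudoChain_orbit T hδ w k)).concat hz
  rw [show 1 + k + 1 = k.succ + 1 by omega] at this
  exact ⟨_, this⟩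

/-- Under a transitive map of a compact space, any two points are joined by a `δ`-chain of
uniformly bounded length. -/
theorem exists_bound_length_isPseudoChain [CompactSpace X] (hT : Continuous T)
    (htrans : IsTransitiveMap T) (hδ : 0 < δ) :
    ∃ L : ℕ, ∀ u v : X, ∃ n, 0 < n ∧ n ≤ L ∧ ∃ x, IsPseudoChain T δ u v n x := by
  let W : ℕ → Set (X × X) := fun k =>
    {p | 0 < k ∧ ∃ w, dist (T p.1) w < δ ∧ dist (T^[k] w) p.2 < δ}
  have hW : ∀ k, IsOpen (W k) := fun k => by
    rw [show W k = {p : X × X | 0 < k} ∩ ⋃ w, ({p : X × X | dist (T p.1) w < δ} ∩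
      {p : X × X | dist (T^[k] w) p.2 < δ}) by ext p; simp [W]]
    refine isOpen_const.inter (isOpen_iUnion fun w => IsOpen.inter ?_ ?_)
    · exact isOpen_lt (by fun_prop) continuous_const
    · exact isOpen_lt (by fun_prop) continuous_const
  have hcov : (univ : Set (X × X)) ⊆ ⋃ k, W k := fun p _ => by
    obtain ⟨k, hk, z, ⟨w, hw, rfl⟩, hz⟩ := htrans (Metric.ball (T p.1) δ) (Metric.ball p.2 δ)
      Metric.isOpen_ball Metric.isOpen_ball ⟨_, Metric.mem_ball_self hδ⟩
      ⟨_, Metric.mem_ball_self hδ⟩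
    exact mem_iUnion.2 ⟨k, hk, w, by simpa [dist_comm] using hw, by simpa using hz⟩
  obtain ⟨t, ht⟩ := isCompact_univ.elim_finite_subcover W hW hcov
  refine ⟨t.sup id + 1, fun u v => ?_⟩
  obtain ⟨k, hkt, hk, w, h1, h2⟩ := mem_iUnion₂.1 (ht (mem_univ (u, v)))
  exact ⟨k + 1, by omega, Nat.succ_le_succ (Finset.le_sup (f := id) hkt),
    exists_isPseudoChain_of_dist_lt hk h1 h2⟩

/-- The pairs (length, sum of `φ`) over all `δ`-chains from `u` to itself through all points
of `A`. -/
def loopSums {E : Type*} [AddCommMonoid E] (T : X → X) (δ : ℝ) (φ : X → E) (A : Finset X)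
    (u : X) : Set (ℕ × E) :=
  {p | 0 < p.1 ∧ ∃ x, IsPseudoChain T δ u u p.1 x ∧ (∀ a ∈ A, ∃ i < p.1, x i = a) ∧
    ∑ i ∈ Finset.range p.1, φ (x i) = p.2}

theorem add_mem_loopSums {E : Type*} [AddCommMonoid E] {φ : X → E} {A : Finset X} {u : X}
    {p q : ℕ × E} (hp : p ∈ loopSums T δ φ A u) (hq : q ∈ loopSums T δ φ A u) :
    p + q ∈ loopSums T δ φ A u := by
  obtain ⟨hp0, x, hx, hxA, hxs⟩ := hp
  obtain ⟨hq0, y, hy, -, hys⟩ := hq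
  refine ⟨Nat.add_pos_left hp0 _, _, hx.concat hy, fun a ha => ?_, ?_⟩
  · obtain ⟨i, hi, hia⟩ := hxA a ha
    exact ⟨i, Nat.lt_add_right _ hi, by rw [concatAt_of_lt hi, hia]⟩
  · rw [Prod.fst_add, sum_concatAt, hxs, hys, Prod.snd_add]

theorem exists_isPseudoChain_through [CompactSpace X] (hT : Continuous T)
    (htrans : IsTransitiveMap T) (hδ : 0 < δ) (u : X) (A : Finset X) :
    ∃ n, 0 < n ∧ ∃ x, IsPseudoChain T δ u u n x ∧ ∀ a ∈ A, ∃ i < n, x i = a := by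
  classical
  obtain ⟨L, hL⟩ := exists_bound_length_isPseudoChain hT htrans hδ
  induction A using Finset.induction_on with
  | empty =>
    obtain ⟨n, hn, -, x, hx⟩ := hL u u
    exact ⟨n, hn, x, hx, by simp⟩
  | insert a A _ ih =>
    obtain ⟨n, hn, x, hx, hxA⟩ := ih
    obtain ⟨k, hk, -, y, hy⟩ := hL u a
    obtain ⟨l, hl, -, z, hz⟩ := hL a u
    refine ⟨_, by omega, _, hx.concat (hy.concat hz), fun b hb => ?_⟩
    rcases Finset.mem_insert.1 hb with rfl | hb
    · refine ⟨n + (k + 0), by omega, ?_⟩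
      rw [concatAt_add, concatAt_add, hz.start]
    · obtain ⟨i, hi, hib⟩ := hxA b hb
      exact ⟨i, by omega, by rw [concatAt_of_lt hi, hib]⟩

end

/-! ### Averages along loops. -/

theorem succ_nsmul_mem_of_add_mem {M : Type*} [AddMonoid M] {S : Set M}
    (hadd : ∀ p ∈ S, ∀ q ∈ S, p + q ∈ S) {p : M} (hp : p ∈ S) {k : ℕ} (hk : 0 < k) :
    k • p ∈ S := by
  induction k, hk using Nat.le_induction with
  | base => simpa using hp
  | succ k _ ih => rw [succ_nsmul]; exact hadd _ ih _ hp

/-- The averages of an additive semigroup of pairs (length, sum) have convex closure. -/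
theorem convex_closure_averages {E : Type*} [NormedAddCommGroup E] [NormedSpace ℝ E]
    {S : Set (ℕ × E)} (hpos : ∀ p ∈ S, 0 < p.1) (hadd : ∀ p ∈ S, ∀ q ∈ S, p + q ∈ S) :
    Convex ℝ (closure ((fun p : ℕ × E => (p.1 : ℝ)⁻¹ • p.2) '' S)) := by
  intro v hv w hw a b ha hb hab
  rw [← closure_closure]
  refine map_mem_closure₂ (f := fun v w : E => a • v + b • w) (by fun_prop) hv hw ?_
  rintro _ ⟨p, hp, rfl⟩ _ ⟨q, hq, rfl⟩
  have hp0 : (p.1 : ℝ) ≠ 0 := by exact_mod_cast (hpos p hp).ne'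
  have hq0 : (q.1 : ℝ) ≠ 0 := by exact_mod_cast (hpos q hq).ne'
  let j : ℕ → ℕ := fun k => ⌊a * k⌋₊
  have hj1 : ∀ k : ℕ, (j k : ℝ) ≤ a * k := fun k => Nat.floor_le (by positivity)
  have hj2 : ∀ k : ℕ, a * k < j k + 1 := fun k => Nat.lt_floor_add_one _
  have hjk : ∀ k : ℕ, j k ≤ k := fun k => by
    have : (j k : ℝ) ≤ k := (hj1 k).trans (mul_le_of_le_one_left (by positivity) (by linarith))
    exact_mod_cast this
  let r : ℕ → ℝ := fun k => (j k + 1) / (k + 2)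
  have hr : Tendsto r atTop (𝓝 a) := by
    have hz : Tendsto (fun k : ℕ => 2 / ((k : ℝ) + 2)) atTop (𝓝 0) :=
      tendsto_const_nhds.div_atTop
        (tendsto_atTop_add_const_right _ _ tendsto_natCast_atTop_atTop)
    rw [tendsto_iff_dist_tendsto_zero]
    refine squeeze_zero (fun _ => dist_nonneg) (fun k => ?_) hz
    have hk : (0 : ℝ) < k + 2 := by positivity
    rw [Real.dist_eq, show r k - a = (j k + 1 - a * (k + 2)) / (k + 2) by
      simp only [r]; field_simp, abs_div, abs_of_pos hk]
    gcongr
    rw [abs_le]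
    constructor <;> linarith [hj1 k, hj2 k]
  have hlim : Tendsto (fun k => r k • ((p.1 : ℝ)⁻¹ • p.2) + (1 - r k) • ((q.1 : ℝ)⁻¹ • q.2))
      atTop (𝓝 (a • ((p.1 : ℝ)⁻¹ • p.2) + b • ((q.1 : ℝ)⁻¹ • q.2))) := by
    rw [show b = 1 - a by linarith]
    exact (hr.smul_const _).add ((hr.const_sub 1).smul_const _)
  refine mem_closure_of_tendsto hlim (Eventually.of_forall fun k => ?_)
  -- The factors q.1 and p.1 equalize the lengths, so the weights are exactly `r k` and 1 - `r k`.
  -- The added 1s keep both multiplicities positive, as S need not contain 0.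
  refine ⟨((j k + 1) * q.1) • p + ((k - j k + 1) * p.1) • q, hadd _ ?_ _ ?_, ?_⟩
  · exact succ_nsmul_mem_of_add_mem hadd hp (Nat.mul_pos (by omega) (hpos q hq))
  · exact succ_nsmul_mem_of_add_mem hadd hq (Nat.mul_pos (by omega) (hpos p hp))
  · have hk : (k : ℝ) + 2 ≠ 0 := by positivity
    simp only [Prod.fst_add, Prod.snd_add, Prod.smul_fst, Prod.smul_snd, smul_eq_mul,
      ← Nat.cast_smul_eq_nsmul ℝ, smul_add, smul_smul]
    push_cast [Nat.cast_sub (hjk k)]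
    have hs : ((j k : ℝ) + 1) * q.1 * p.1 + (k - j k + 1) * p.1 * q.1 = (k + 2) * p.1 * q.1 := by
      ring
    rw [hs]
    congr 2
    · simp only [r]; field_simp
    · simp only [r]; field_simp; ring

theorem norm_sum_range_le {X E : Type*} [NormedAddCommGroup E] {φ : X → E} {B : ℝ}
    (hB : ∀ x, ‖φ x‖ ≤ B) (x : ℕ → X) (n : ℕ) :
    ‖∑ i ∈ Finset.range n, φ (x i)‖ ≤ n * B := by
  simpa using norm_sum_le_of_le (Finset.range n) fun i _ => hB (x i)

section

variable {X E : Type*} [MetricSpace X] [CompactSpace X] [NormedAddCommGroup E] [NormedSpace ℝ E]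
  {T : X → X} {δ : ℝ}

/-- Birkhoff averages of length `N` are within `O(1 / N)`, uniformly, of the averages along
`δ`-chains from `u` to `u` through all points of `A`. -/
theorem exists_average_loopSums_near_birkhoffAverage (hT : Continuous T)
    (htrans : IsTransitiveMap T) (hδ : 0 < δ) {φ : X → E} (hφ : Continuous φ) (A : Finset X)
    (u : X) :
    ∃ C : ℝ, ∀ (x : X) (N : ℕ), 0 < N → ∃ p ∈ loopSums T δ φ A u,
      dist (birkhoffAverage ℝ T φ N x) ((p.1 : ℝ)⁻¹ • p.2) ≤ C / N := by
  obtain ⟨B, hB⟩ := isCompact_univ.exists_bound_of_continuousOn hφ.continuousOn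
  have hB : ∀ x, ‖φ x‖ ≤ B := fun x => hB x (mem_univ x)
  have hB0 : 0 ≤ B := (norm_nonneg _).trans (hB u)
  obtain ⟨L, hL⟩ := exists_bound_length_isPseudoChain hT htrans hδ
  obtain ⟨n₀, hn₀, x₀, hx₀, hA⟩ := exists_isPseudoChain_through hT htrans hδ u A
  -- The loop adds to the orbit segment at most n₀ + 2L points, each contributing at most B directly
  -- and B through the change of normalization.
  refine ⟨2 * ((n₀ + 2 * L) * B), fun x N hN => ?_⟩
  obtain ⟨m₁, -, hm₁, y₁, hy₁⟩ := hL u x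
  obtain ⟨m₂, -, hm₂, y₂, hy₂⟩ := hL (T^[N] x) u
  set s₀ := ∑ i ∈ Finset.range n₀, φ (x₀ i)
  set s₁ := ∑ i ∈ Finset.range m₁, φ (y₁ i)
  set s₂ := ∑ i ∈ Finset.range m₂, φ (y₂ i)
  set a := birkhoffAverage ℝ T φ N x with ha
  have hN' : (N : ℝ) ≠ 0 := by exact_mod_cast hN.ne'
  have hσ : ∑ i ∈ Finset.range N, φ (T^[i] x) = (N : ℝ) • a := by
    rw [ha, birkhoffAverage, smul_inv_smul₀ hN', birkhoffSum]
  refine ⟨(n₀ + (m₁ + (N + m₂)), s₀ + (s₁ + ((N : ℝ) • a + s₂))), ⟨by omega, _,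
    hx₀.concat (hy₁.concat ((isPseudoChain_orbit T hδ x N).concat hy₂)), fun b hb => ?_, ?_⟩, ?_⟩
  · obtain ⟨i, hi, hib⟩ := hA b hb
    exact ⟨i, by omega, by rw [concatAt_of_lt hi, hib]⟩
  · simp only [sum_concatAt, hσ, s₀, s₁, s₂]
  · simp only
    set n : ℝ := ((n₀ + (m₁ + (N + m₂)) : ℕ) : ℝ) with hn
    have hn1 : n = n₀ + m₁ + m₂ + N := by rw [hn]; push_cast; ring
    have hN0 : (0 : ℝ) < N := by exact_mod_cast hN
    have hn0 : 0 < n := by rw [hn1]; positivity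
    have hNn : (N : ℝ) ≤ n := by
      rw [hn1]; linarith [(n₀.cast_nonneg : (0 : ℝ) ≤ n₀), (m₁.cast_nonneg : (0 : ℝ) ≤ m₁),
        (m₂.cast_nonneg : (0 : ℝ) ≤ m₂)]
    have hd : (n₀ + m₁ + m₂ : ℝ) ≤ n₀ + 2 * L := by
      have h1 : (m₁ : ℝ) ≤ L := by exact_mod_cast hm₁
      have h2 : (m₂ : ℝ) ≤ L := by exact_mod_cast hm₂
      linarith
    have haB : ‖a‖ ≤ B := by
      have h := norm_sum_range_le hB (fun i => T^[i] x) N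
      rw [hσ, norm_smul, Real.norm_of_nonneg hN0.le] at h
      exact le_of_mul_le_mul_left h hN0
    have he : a - n⁻¹ • (s₀ + (s₁ + ((N : ℝ) • a + s₂))) =
        n⁻¹ • ((n₀ + m₁ + m₂ : ℝ) • a - (s₀ + s₁ + s₂)) := by
      have : a = n⁻¹ • (n • a) := (inv_smul_smul₀ hn0.ne' a).symm
      conv_lhs => enter [1]; rw [this]
      rw [← smul_sub, hn1, add_smul _ (N : ℝ)]
      congr 1
      abel
    rw [dist_eq_norm, he, norm_smul, norm_inv, Real.norm_of_nonneg hn0.le, div_eq_inv_mul]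
    refine mul_le_mul (inv_anti₀ hN0 hNn) ?_ (norm_nonneg _) (by positivity)
    have h1 : ‖s₀ + s₁ + s₂‖ ≤ (n₀ + m₁ + m₂) * B := by
      refine norm_add₃_le.trans ?_
      linarith [norm_sum_range_le hB x₀ n₀, norm_sum_range_le hB y₁ m₁,
        norm_sum_range_le hB y₂ m₂]
    have h2 : ‖(n₀ + m₁ + m₂ : ℝ) • a‖ ≤ (n₀ + m₁ + m₂) * B := by
      rw [norm_smul, Real.norm_of_nonneg (by positivity)]
      gcongr
    have h3 : (n₀ + m₁ + m₂ : ℝ) * B ≤ (n₀ + 2 * L) * B := by gcongr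
    linarith [norm_sub_le ((n₀ + m₁ + m₂ : ℝ) • a) (s₀ + s₁ + s₂)]

/-- The integral of `φ` against an invariant measure is a limit of averages along closed
`δ`-chains. -/
theorem integral_mem_closure_averages_loopSums [MeasurableSpace X] [BorelSpace X]
    [CompleteSpace E] [SecondCountableTopology E] (hT : Continuous T)
    (htrans : IsTransitiveMap T) (hδ : 0 < δ) {φ : X → E} (hφ : Continuous φ) (A : Finset X)
    (u : X) {μ : Measure X} [IsProbabilityMeasure μ] (hμ : MeasurePreserving T μ μ) :
    ∫ x, φ x ∂μ ∈
      closure ((fun p : ℕ × E => (p.1 : ℝ)⁻¹ • p.2) '' loopSums T δ φ A u) := by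
  obtain ⟨C, hC⟩ := exists_average_loopSums_near_birkhoffAverage hT htrans hδ hφ A u
  set V := (fun p : ℕ × E => (p.1 : ℝ)⁻¹ • p.2) '' loopSums T δ φ A u
  have hconv : Convex ℝ (closure V) :=
    convex_closure_averages (fun p hp => hp.1) fun p hp q hq => add_mem_loopSums hp hq
  rw [← closure_closure, Metric.closure_eq_iInter_cthickening]
  refine mem_iInter₂.2 fun ε hε => ?_
  obtain ⟨N, hN⟩ := exists_nat_gt (max (C / ε) 0)
  have hN0 : (0 : ℝ) < N := (le_max_right _ _).trans_lt hN
  have hN1 : 0 < N := by exact_mod_cast hN0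
  have hCN : C / N ≤ ε := by
    rw [div_le_iff₀ hN0, mul_comm]
    exact ((div_lt_iff₀ hε).1 ((le_max_left _ _).trans_lt hN)).le
  rw [← integral_birkhoffAverage hμ hφ.integrable_of_compactSpace hN1.ne']
  -- All values of the N-th average lie in this closed convex thickening, hence so does their
  -- integral.
  refine (hconv.cthickening ε).integral_mem Metric.isClosed_cthickening
    (Eventually.of_forall fun x => ?_)
    (continuous_birkhoffAverage hT hφ N).integrable_of_compactSpace
  obtain ⟨p, hp, hd⟩ := hC x N hN1
  exact Metric.mem_cthickening_of_dist_le _ _ _ _ (subset_closure ⟨p, hp, rfl⟩) (hd.trans hCN)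

end

/-- Finitely many integrals against an invariant measure are approximated by averages along a
periodic pseudo-orbit through prescribed points. -/
theorem exists_periodic_isPseudoOrbit_average_near {X : Type*} [MetricSpace X] [CompactSpace X]
    [Nonempty X] [MeasurableSpace X] [BorelSpace X] {T : X → X} {δ : ℝ} (hT : Continuous T)
    (htrans : IsTransitiveMap T) (hδ : 0 < δ) (F : Finset C(X, ℝ)) (A : Finset X)
    {μ : Measure X} [IsProbabilityMeasure μ] (hμ : MeasurePreserving T μ μ) {κ : ℝ}
    (hκ : 0 < κ) :
    ∃ (n : ℕ) (z : ℕ → X), 0 < n ∧ Periodic z n ∧ IsPseudoOrbit T δ z ∧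
      (∀ a ∈ A, ∃ i < n, z i = a) ∧
      ∀ f ∈ F, |(n : ℝ)⁻¹ * ∑ i ∈ Finset.range n, f (z i) - ∫ x, f x ∂μ| < κ := by
  obtain ⟨u⟩ := ‹Nonempty X›
  -- A single vector-valued observable, so that one loop serves all of F.
  let φ : X → F → ℝ := fun x f => f.1 x
  have hφ : Continuous φ := continuous_pi fun f => f.1.continuous
  have hmem := integral_mem_closure_averages_loopSums hT htrans hδ hφ A u hμ
  obtain ⟨_, ⟨⟨n, s⟩, ⟨hn, x, hx, hxA, hxs⟩, rfl⟩, hd⟩ := Metric.mem_closure_iff.1 hmem κ hκ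
  simp only at hn hx hxA hxs hd
  have hmod : ∀ i < n, x (i % n) = x i := fun i hi => by rw [Nat.mod_eq_of_lt hi]
  refine ⟨n, fun i => x (i % n), hn, fun i => by simp, fun i => ?_, fun a ha => ?_,
    fun f hf => ?_⟩
  · have h := hx.step (i % n) (Nat.mod_lt _ hn)
    suffices h' : x ((i + 1) % n) = x (i % n + 1) by
      change dist (T (x (i % n))) (x ((i + 1) % n)) < δ
      rwa [h']
    rw [← Nat.mod_add_mod]
    rcases (Nat.succ_le_of_lt (Nat.mod_lt i hn)).lt_or_eq with h1 | h1
    · rw [Nat.mod_eq_of_lt h1]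
    · rw [Nat.succ_eq_add_one] at h1
      rw [h1, Nat.mod_self, hx.start, hx.finish]
  · obtain ⟨i, hi, hia⟩ := hxA a ha
    exact ⟨i, hi, (hmod i hi).trans hia⟩
  · have h1 := (dist_le_pi_dist _ _ (⟨f, hf⟩ : F)).trans_lt hd
    rw [eval_integral (fun g => g.1.continuous.integrable_of_compactSpace), dist_comm,
      Real.dist_eq] at h1
    rw [Finset.sum_congr rfl fun i hi => congrArg f (hmod i (Finset.mem_range.1 hi))]
    simpa [← hxs, φ] using h1

theorem Function.Periodic.sum_range_add_eq {M : Type*} [AddCommMonoid M] {z : ℕ → M} {n : ℕ}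
    (hz : Periodic z n) (r : ℕ) :
    ∑ i ∈ Finset.range n, z (r + i) = ∑ i ∈ Finset.range n, z i := by
  induction r with
  | zero => simp
  | succ r ih =>
    rw [← ih]
    cases n with
    | zero => simp
    | succ n =>
      rw [Finset.sum_range_succ, Finset.sum_range_succ']
      congr 1
      · exact Finset.sum_congr rfl fun i _ => by congr 1; ring
      · rw [add_zero, ← hz r]; congr 1; ring

/-! ### The invariant set traced by a periodic pseudo-orbit. -/

/-- The points whose orbit stays `η`-close to some shift of the `n`-periodic sequence `z`. -/
def shadowingSet {X : Type*} [MetricSpace X] (T : X → X) (z : ℕ → X) (n : ℕ) (η : ℝ) : Set X :=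
  {w | ∃ r < n, ∀ j, dist (T^[j] w) (z (r + j)) ≤ η}

section

variable {X : Type*} [MetricSpace X] {T : X → X} {z : ℕ → X} {n : ℕ} {η : ℝ}

theorem isClosed_shadowingSet (hT : Continuous T) : IsClosed (shadowingSet T z n η) := by
  have : shadowingSet T z n η =
      ⋃ r ∈ Finset.range n, ⋂ j, {w | dist (T^[j] w) (z (r + j)) ≤ η} := by
    ext w; simp [shadowingSet]
  rw [this]
  refine isClosed_biUnion_finset fun r _ => isClosed_iInter fun j => ?_
  exact isClosed_le ((hT.iterate j).dist continuous_const) continuous_const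

theorem mapsTo_shadowingSet (hn : 0 < n) (hz : Periodic z n) :
    MapsTo T (shadowingSet T z n η) (shadowingSet T z n η) := by
  rintro w ⟨r, -, hw⟩
  refine ⟨(r + 1) % n, Nat.mod_lt _ hn, fun j => ?_⟩
  have h : z ((r + 1) % n + j) = z (r + (j + 1)) := by
    rw [← hz.map_mod_nat, Nat.mod_add_mod, hz.map_mod_nat]
    congr 1; ring
  rw [h, ← iterate_succ_apply]
  exact hw (j + 1)

theorem exists_iterate_near_of_mem_shadowingSet (hz : Periodic z n) {w : X}
    (hw : w ∈ shadowingSet T z n η) (i : ℕ) : ∃ k, dist (T^[k] w) (z i) ≤ η := by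
  obtain ⟨r, hr, hw⟩ := hw
  refine ⟨n - r + i, ?_⟩
  have h := hw (n - r + i)
  rwa [show r + (n - r + i) = i + n by omega, hz] at h

theorem abs_birkhoffAverage_sub_le_of_mem_shadowingSet (hn : 0 < n) (hz : Periodic z n)
    {f : X → ℝ} {κ : ℝ} (hf : ∀ x y, dist x y ≤ η → |f x - f y| ≤ κ) {w : X}
    (hw : w ∈ shadowingSet T z n η) :
    |birkhoffAverage ℝ T f n w - (n : ℝ)⁻¹ * ∑ i ∈ Finset.range n, f (z i)| ≤ κ := by
  obtain ⟨r, hr, hw⟩ := hw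
  have hn0 : (0 : ℝ) < n := by exact_mod_cast hn
  rw [← Periodic.sum_range_add_eq (z := fun i => f (z i)) (fun i => congrArg f (hz i)) r,
    birkhoffAverage, birkhoffSum, smul_eq_mul, ← mul_sub, ← Finset.sum_sub_distrib, abs_mul,
    abs_of_pos (inv_pos.2 hn0), inv_mul_le_iff₀ hn0]
  refine (Finset.abs_sum_le_sum_abs _ _).trans
    ((Finset.sum_le_sum fun i _ => hf _ _ (hw i)).trans_eq ?_)
  simp

end

/-- The orbit of x meets the disjoint closed η-balls about the points of A, so it has at least |A|
distinct points. By invariance each has mass at least ν {x}. -/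
theorem card_mul_measure_singleton_le_one {X : Type*} [MetricSpace X] [MeasurableSpace X]
    [BorelSpace X] {T : X → X} {ν : Measure X} [IsProbabilityMeasure ν]
    (hν : MeasurePreserving T ν ν) {A : Finset X} {η : ℝ}
    (hA : ∀ a ∈ A, ∀ b ∈ A, a ≠ b → 2 * η < dist a b) {x : X}
    (hx : ∀ a ∈ A, ∃ k, dist (T^[k] x) a ≤ η) :
    (A.card : ℝ≥0∞) * ν {x} ≤ 1 := by
  classical
  choose! k hk using hx
  have hinj : Set.InjOn (fun a => T^[k a] x) A := fun a ha b hb hab => by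
    by_contra hne
    have h1 := hA a ha b hb hne
    have h2 := hk a ha
    have h3 := hk b hb
    simp only at hab
    rw [hab] at h2
    linarith [dist_triangle_left a b (T^[k b] x)]
  calc (A.card : ℝ≥0∞) * ν {x} = ∑ a ∈ A, ν {x} := by simp
    _ ≤ ∑ a ∈ A, ν {T^[k a] x} := Finset.sum_le_sum fun a _ => by
        rw [← (hν.iterate (k a)).measure_preimage
          (measurableSet_singleton (T^[k a] x)).nullMeasurableSet]
        exact measure_mono (singleton_subset_iff.2 rfl)
    _ = ∑ y ∈ A.image fun a => T^[k a] x, ν {y} :=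
        (Finset.sum_image (f := fun y => ν {y}) hinj).symm
    _ = ν (A.image fun a => T^[k a] x : Finset X) := sum_measure_singleton
    _ ≤ 1 := prob_le_one

theorem Finset.exists_pos_forall_lt_dist {X : Type*} [MetricSpace X] (A : Finset X) :
    ∃ ρ : ℝ, 0 < ρ ∧ ∀ a ∈ A, ∀ b ∈ A, a ≠ b → ρ < dist a b := by
  classical
  have h : ∀ᶠ ρ : ℝ in 𝓝[>] 0, ∀ p ∈ A.offDiag, ρ < dist p.1 p.2 :=
    (Filter.eventually_all_finset _).2 fun p hp =>
      nhdsWithin_le_nhds (Iio_mem_nhds (dist_pos.2 (Finset.mem_offDiag.1 hp).2.2))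
  obtain ⟨ρ, hρ, hρ0⟩ := (h.and self_mem_nhdsWithin).exists
  exact ⟨ρ, hρ0, fun a ha b hb hab => hρ (a, b) (Finset.mem_offDiag.2 ⟨ha, hb, hab⟩)⟩

/-! ### Density and the residual set. -/

/-- Every invariant measure is approximated by invariant measures with small atoms and small
variance of the Birkhoff averages of given observables. -/
theorem exists_mem_invariantMeasures_near {X : Type*} [MetricSpace X] [CompactSpace X]
    [Infinite X] [MeasurableSpace X] [BorelSpace X] {T : X → X} (hT : Continuous T)
    (htrans : IsTransitiveMap T) (hshadow : HasShadowing T) {μ : ProbabilityMeasure X}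
    (hμ : μ ∈ invariantMeasures T) (F : Finset C(X, ℝ)) (M : ℕ) {κ : ℝ} (hκ : 0 < κ) :
    ∃ ν ∈ invariantMeasures T, (∀ x, (M : ℝ≥0∞) * (ν : Measure X) {x} ≤ 1) ∧
      ∀ f ∈ F, |∫ x, f x ∂(ν : Measure X) - ∫ x, f x ∂(μ : Measure X)| ≤ κ ∧
        ∃ n : ℕ, n ≠ 0 ∧ ∫ x, (birkhoffAverage ℝ T f n x) ^ 2 ∂(ν : Measure X) -
          (∫ x, f x ∂(ν : Measure X)) ^ 2 ≤ (2 * κ) ^ 2 := by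
  obtain ⟨A, hAM⟩ := Infinite.exists_subset_card_eq X M
  obtain ⟨ρ, hρ, hA⟩ := A.exists_pos_forall_lt_dist
  have hφ : ∃ η₀ > 0, ∀ f ∈ F, ∀ x y : X, dist x y < η₀ → |f x - f y| ≤ κ / 2 := by
    have hc : UniformContinuous fun (x : X) (f : F) => f.1 x :=
      CompactSpace.uniformContinuous_of_continuous (continuous_pi fun f => f.1.continuous)
    obtain ⟨η₀, h0, h⟩ := Metric.uniformContinuous_iff.1 hc (κ / 2) (by positivity)
    exact ⟨η₀, h0, fun f hf x y hxy =>
      (dist_le_pi_dist _ _ (⟨f, hf⟩ : F)).trans (h hxy).le⟩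
  obtain ⟨η₀, hη₀, hF⟩ := hφ
  set η := min (ρ / 2) (η₀ / 2)
  have hη0 : 0 < η := by positivity
  have hηρ : 2 * η ≤ ρ := by linarith [min_le_left (ρ / 2) (η₀ / 2)]
  have hηη : η < η₀ := by linarith [min_le_right (ρ / 2) (η₀ / 2)]
  obtain ⟨δ, hδ, hsh⟩ := hshadow η hη0
  obtain ⟨n, z, hn, hz, hpo, hzA, hzF⟩ := exists_periodic_isPseudoOrbit_average_near hT htrans hδ
    F A hμ (half_pos hκ)
  obtain ⟨y, hy⟩ := hsh z hpo
  obtain ⟨ν, hν, hνZ⟩ := exists_mem_invariantMeasures_of_isClosed hT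
    (isClosed_shadowingSet (z := z) (n := n) (η := η) hT)
    ⟨y, 0, hn, fun j => by simpa using (hy j).le⟩ (mapsTo_shadowingSet hn hz)
  have hν' : MeasurePreserving T (ν : Measure X) (ν : Measure X) := hν
  refine ⟨ν, hν, fun x => ?_, fun f hf => ?_⟩
  · by_cases hx : x ∈ shadowingSet T z n η
    · rw [← hAM]
      refine card_mul_measure_singleton_le_one (η := η) hν'
        (fun a ha b hb hab => hηρ.trans_lt (hA a ha b hb hab)) fun a ha => ?_
      obtain ⟨i, -, rfl⟩ := hzA a ha
      exact exists_iterate_near_of_mem_shadowingSet hz hx i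
    · rw [measure_mono_null (singleton_subset_iff.2 hx) hνZ]
      simp
  · set c := ∫ x, f x ∂(μ : Measure X)
    have hAc := continuous_birkhoffAverage hT f.continuous n
    have hae : ∀ᵐ w ∂(ν : Measure X), |birkhoffAverage ℝ T f n w - c| ≤ κ := by
      filter_upwards [compl_mem_ae_iff.2 hνZ] with w hw
      rw [compl_compl] at hw
      have h1 := abs_birkhoffAverage_sub_le_of_mem_shadowingSet hn hz
        (fun x y hxy => hF f hf x y (hxy.trans_lt hηη)) hw
      linarith [hzF f hf, abs_sub_le (birkhoffAverage ℝ T f n w)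
        ((n : ℝ)⁻¹ * ∑ i ∈ Finset.range n, f (z i)) c]
    have hmean : |∫ x, f x ∂(ν : Measure X) - c| ≤ κ := by
      have h1 := norm_integral_le_of_norm_le_const (f := fun w => birkhoffAverage ℝ T f n w - c) hae
      rw [integral_sub hAc.integrable_of_compactSpace (integrable_const _),
        integral_birkhoffAverage hν' f.continuous.integrable_of_compactSpace hn.ne'] at h1
      simpa using h1
    refine ⟨hmean, n, hn.ne', ?_⟩
    rw [← integral_birkhoffAverage_sub_sq hT hν' f.continuous hn.ne']
    have h2 : ∀ᵐ w ∂(ν : Measure X),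
        ‖(birkhoffAverage ℝ T f n w - ∫ x, f x ∂(ν : Measure X)) ^ 2‖ ≤ (2 * κ) ^ 2 := by
      filter_upwards [hae] with w hw
      rw [norm_pow, Real.norm_eq_abs]
      refine pow_le_pow_left₀ (abs_nonneg _) ?_ 2
      rw [abs_sub_comm] at hmean
      linarith [abs_sub_le (birkhoffAverage ℝ T f n w) c (∫ x, f x ∂(ν : Measure X))]
    have h3 := norm_integral_le_of_norm_le_const h2
    rw [probReal_univ, mul_one] at h3
    exact (le_abs_self _).trans h3

theorem dense_setOf_invariantMeasures {X : Type*} [MetricSpace X] [MeasurableSpace X]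
    [BorelSpace X] {T : X → X} {P : ProbabilityMeasure X → Prop}
    (h : ∀ μ ∈ invariantMeasures T, ∀ (F : Finset C(X, ℝ)) (κ : ℝ), 0 < κ →
      ∃ ν ∈ invariantMeasures T, P ν ∧
        ∀ f ∈ F, |∫ x, f x ∂(ν : Measure X) - ∫ x, f x ∂(μ : Measure X)| ≤ κ) :
    Dense {μ : invariantMeasures T | P μ} := by
  classical
  intro μ
  -- A net indexed by finite sets of observables and precisions 1/(m+1) converges weakly to μ.
  choose ν hν hP hF using fun i : Finset C(X, ℝ) × ℕ =>
    h μ μ.2 i.1 (1 / ((i.2 : ℝ) + 1)) (by positivity)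
  refine mem_closure_of_tendsto (f := fun i => (⟨ν i, hν i⟩ : invariantMeasures T))
    (b := atTop) ?_ (Eventually.of_forall hP)
  refine tendsto_subtype_rng.2 (ProbabilityMeasure.tendsto_iff_forall_integral_tendsto.2
    fun g => ?_)
  rw [tendsto_iff_dist_tendsto_zero]
  have hz : Tendsto (fun i : Finset C(X, ℝ) × ℕ => 1 / ((i.2 : ℝ) + 1)) atTop (𝓝 0) :=
    tendsto_one_div_add_atTop_nhds_zero_nat.comp (by
      rw [← prod_atTop_atTop_eq]; exact tendsto_snd)
  refine squeeze_zero' (Eventually.of_forall fun _ => dist_nonneg) ?_ hz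
  filter_upwards [eventually_ge_atTop (({g.toContinuousMap}, 0) : Finset C(X, ℝ) × ℕ)] with i hi
  exact hF i g.toContinuousMap (hi.1 (Finset.mem_singleton_self _))

theorem mainTheorem7 {X : Type*} [MetricSpace X] [CompactSpace X] [Infinite X]
    [MeasurableSpace X] [BorelSpace X] (T : X → X) (hT : Continuous T)
    (htrans : IsTransitiveMap T) (hshadow : HasShadowing T) :
    {μ : invariantMeasures T |
        (∀ x : X, ((μ : ProbabilityMeasure X) : Measure X) {x} = 0) ∧
          Ergodic T ((μ : ProbabilityMeasure X) : Measure X)} ∈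
      residual (invariantMeasures T) := by
  classical
  have hatom : ∀ k : ℕ, {μ : invariantMeasures T |
      ∀ x, ((μ : ProbabilityMeasure X) : Measure X) {x} < (k + 1 : ℝ≥0∞)⁻¹} ∈
        residual (invariantMeasures T) := fun k => by
    refine residual_of_dense_open
      ((isOpen_setOf_forall_measure_singleton_lt _).preimage continuous_subtype_val)
      (dense_setOf_invariantMeasures (P := fun ν : ProbabilityMeasure X => ∀ x,
          (ν : Measure X) {x} < (k + 1 : ℝ≥0∞)⁻¹)
        fun μ hμ F κ hκ => ?_)
    -- With k + 2 points the bound 1/(k+2) is strictly below 1/(k+1).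
    obtain ⟨ν, hν, h1, h2⟩ := exists_mem_invariantMeasures_near hT htrans hshadow hμ F (k + 2) hκ
    refine ⟨ν, hν, fun x => ?_, fun f hf => (h2 f hf).1⟩
    have h3 : (ν : Measure X) {x} ≤ ((k + 2 : ℕ) : ℝ≥0∞)⁻¹ := by
      rw [ENNReal.le_inv_iff_mul_le, mul_comm]
      exact h1 x
    refine h3.trans_lt (ENNReal.inv_lt_inv.2 ?_)
    exact_mod_cast Nat.lt_succ_self (k + 1)
  have hvar : ∀ (f : C(X, ℝ)) (k : ℕ), {μ : invariantMeasures T | ∃ n : ℕ, n ≠ 0 ∧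
      ∫ x, (birkhoffAverage ℝ T f n x) ^ 2 ∂((μ : ProbabilityMeasure X) : Measure X) -
        (∫ x, f x ∂((μ : ProbabilityMeasure X) : Measure X)) ^ 2 < 1 / ((k : ℝ) + 1)} ∈
        residual (invariantMeasures T) := fun f k => by
    refine residual_of_dense_open
      ((isOpen_setOf_birkhoffAverage_variance_lt hT f _).preimage continuous_subtype_val)
      (dense_setOf_invariantMeasures (P := fun ν : ProbabilityMeasure X => ∃ n : ℕ, n ≠ 0 ∧
        ∫ x, (birkhoffAverage ℝ T f n x) ^ 2 ∂(ν : Measure X) -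
          (∫ x, f x ∂(ν : Measure X)) ^ 2 < 1 / ((k : ℝ) + 1)) fun μ hμ F κ hκ => ?_)
    have hk : (0 : ℝ) < 1 / (k + 1) := by positivity
    -- Atoms play no role here, hence M = 0. With s = 1/(k+1) ≤ 1 and tolerance at most s/5, the
    -- variance is at most 4s²/25 < s.
    obtain ⟨ν, hν, -, h2⟩ := exists_mem_invariantMeasures_near hT htrans hshadow hμ
      (insert f F) 0 (κ := min κ (1 / (k + 1) / 5)) (by positivity)
    have hle := min_le_right κ ((1 : ℝ) / (k + 1) / 5)
    have hpos : 0 < min κ ((1 : ℝ) / (k + 1) / 5) := by positivity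
    refine ⟨ν, hν, ?_, fun g hg =>
      ((h2 g (Finset.mem_insert_of_mem hg)).1).trans (min_le_left _ _)⟩
    obtain ⟨-, n, hn, hlt⟩ := h2 f (Finset.mem_insert_self _ _)
    refine ⟨n, hn, hlt.trans_lt ?_⟩
    have hk1 : (1 : ℝ) / (k + 1) ≤ 1 := by
      rw [div_le_one (by positivity)]; linarith [(k.cast_nonneg : (0 : ℝ) ≤ k)]
    nlinarith
  obtain ⟨D, hDc, hDd⟩ := TopologicalSpace.exists_countable_dense C(X, ℝ)
  have h1 := eventually_countable_forall.2 hatom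
  have h2 := (eventually_countable_ball hDc).2 fun f _ => eventually_countable_forall.2 (hvar f)
  filter_upwards [h1, h2] with μ hμ1 hμ2
  refine ⟨fun x => ?_, ergodic_of_birkhoffAverage_variance hT μ.2 hDd fun f hf ε hε => ?_⟩
  · refine le_antisymm (le_of_forall_gt fun ε hε => ?_) zero_le
    obtain ⟨k, hk⟩ := ENNReal.exists_inv_nat_lt hε.ne'
    refine (hμ1 k x).trans (lt_of_le_of_lt (ENNReal.inv_le_inv.2 ?_) hk)
    exact le_self_add
  · obtain ⟨k, hk⟩ := exists_nat_one_div_lt hε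
    obtain ⟨n, hn, h⟩ := hμ2 f hf k
    exact ⟨n, hn, h.trans hk⟩
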